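/- Manifolds are finite-dimensional, smooth, Hausdorff, second countable and without boundary. Let $\Phi : G \times M \to M$, $\Phi(g,p) = g\cdot p$, be a smooth, free and proper left action of a Lie group $G$ on a manifold $M$; write $\Phi^p : G \to M$, $g \mapsto g\cdot p$, let $L_g, R_g$ be the left and right translations of $G$, let $e$ be the identity and $\mathfrak g = T_eG$. Let $W$ be a group linear vector field on $G$ (that is, $W\in\mathfrak{aut}(G)$: $W$ is smooth and $W(gh) = dL_g\,W(h) + dR_h\,W(g)$ for all $g,h \in G$), and let $V$ be a smooth vector field on $M$ that is weakly $\Phi$-invariant with respect to $W$, i.e. $d\Phi\big(W(g),V(p)\big) = V(\Phi(g,p))$ for all $g\in G$, $p\in M$. Then the orbit space $M/G$ with the quotient topology carries a smooth manifold structure for which the projection $\pi : M \to M/G$ is a smooth submersion. Moreover, for $M/G$ with such a structure, suppose that $\pi$ has a smooth global section $s : M/G \to M$. Then: 1. There is a smooth vector field $\tilde V$ on $M/G$ with $\tilde V(\pi(p)) = d\pi\,V(p)$ for all $p\in M$; for each $y \in M/G$ the differential $d\Phi^{s(y)} : \mathfrak g \to T_{s(y)}M$ at $e$ is injective, and its image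 contains $V(s(y)) - ds\,\tilde V(y)$, so that $$\hat V(y) = \big(d\Phi^{s(y)}\big)^{-1}\big(V(s(y)) - ds\,\tilde V(y)\big) \in \mathfrak g$$ is well defined. 2. Every $p \in M$ can be written in exactly one way as $p = \Phi_g(s(y))$ with $g\in G$, $y \in M/G$. If $J\subseteq\mathbb R$ is an interval, $p : J \to M$ is a curve satisfying $\dot p = V(p)$, and $p(t) = \Phi_{g(t)}(s(y(t)))$ for $t \in J$, then $y$ and $g$ are differentiable on $J$ and satisfy the cascade $$\dot y = \tilde V(y), \qquad \dot g = W(g) + dL_g\,\hat V(y).$$ 3. The motion along the orbits is group affine: for each fixed $y \in M/G$, the field $X(g) = W(g) + dL_g\,\hat V(y)$ on $G$ is smooth and satisfies $X(gh) = dL_g\,X(h) + dR_h\,X(g) - dL_g\,dR_h\,X(e)$ for all $g,h\in G$. -/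

import Mathlib

open scoped Manifold ContDiff

noncomputable section

section VectorFields

variable {E : Type*} [NormedAddCommGroup E] [NormedSpace ℝ E]

/-- A (possibly non-smooth) section `V` of the tangent bundle of `M` is a vector field,
`V ∈ 𝔛(M)`, if it is smooth as a map `M → TM`. -/
def IsSmoothVectorField {M : Type*} [TopologicalSpace M] [ChartedSpace E M] [IsManifold 𝓘(ℝ, E) ∞ M]
    (V : ∀ p : M, TangentSpace 𝓘(ℝ, E) p) : Prop :=
  ContMDiff 𝓘(ℝ, E) 𝓘(ℝ, E).tangent ∞ (fun p : M => (⟨p, V p⟩ : TangentBundle 𝓘(ℝ, E) M))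

/-- Group linear vector fields, `W ∈ aut(G)`: smooth vector fields on the Lie group `G` with
`W(gh) = dL_g (W(h)) + dR_h (W(g))`. -/
def IsGroupLinear {G : Type*} [TopologicalSpace G] [ChartedSpace E G] [Group G]
    [LieGroup 𝓘(ℝ, E) ∞ G] (W : ∀ g : G, TangentSpace 𝓘(ℝ, E) g) : Prop :=
  IsSmoothVectorField W ∧
    ∀ g h : G, W (g * h) =
      mfderiv 𝓘(ℝ, E) 𝓘(ℝ, E) (fun x : G => g * x) h (W h) +
        mfderiv 𝓘(ℝ, E) 𝓘(ℝ, E) (fun x : G => x * h) g (W g)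

/-- Group affine vector fields: smooth vector fields on the Lie group `G` with
`X(gh) = dL_g (X(h)) + dR_h (X(g)) - dL_g (dR_h (X(e)))`. -/
def IsGroupAffine {G : Type*} [TopologicalSpace G] [ChartedSpace E G] [Group G]
    [LieGroup 𝓘(ℝ, E) ∞ G] (X : ∀ g : G, TangentSpace 𝓘(ℝ, E) g) : Prop :=
  IsSmoothVectorField X ∧
    ∀ g h : G, X (g * h) =
      mfderiv 𝓘(ℝ, E) 𝓘(ℝ, E) (fun x : G => g * x) h (X h) +
        mfderiv 𝓘(ℝ, E) 𝓘(ℝ, E) (fun x : G => x * h) g (X g) -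
        mfderiv 𝓘(ℝ, E) 𝓘(ℝ, E) (fun x : G => g * x) h
          (mfderiv 𝓘(ℝ, E) 𝓘(ℝ, E) (fun x : G => x * h) 1 (X 1))

end VectorFields

section Actions

variable {EG EM : Type*} [NormedAddCommGroup EG] [NormedSpace ℝ EG]
  [NormedAddCommGroup EM] [NormedSpace ℝ EM]

/-- With `Φ(g, p) = g • p`, the field `V` on `M` is weakly `Φ`-invariant with respect to the field
`W` on `G`: `dΦ (W(g), V(p)) = V(Φ(g, p))` for all `g` and `p`. -/
def IsWeaklyInvariant {G M : Type*} [TopologicalSpace G] [ChartedSpace EG G] [Group G]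
    [TopologicalSpace M] [ChartedSpace EM M] [MulAction G M]
    (V : ∀ p : M, TangentSpace 𝓘(ℝ, EM) p) (W : ∀ g : G, TangentSpace 𝓘(ℝ, EG) g) : Prop :=
  ∀ (g : G) (p : M),
    mfderiv (𝓘(ℝ, EG).prod 𝓘(ℝ, EM)) 𝓘(ℝ, EM) (fun q : G × M => q.1 • q.2) (g, p) (W g, V p) =
      V (g • p)

/-- The orbit projection `π : M → M/G`; the orbit space `M/G` carries the quotient topology. -/
def orbitProj (G M : Type*) [Group G] [MulAction G M] (p : M) : MulAction.orbitRel.Quotient G M :=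
  Quotient.mk (MulAction.orbitRel G M) p

/-- A smooth global section `s : M/G → M` of `π`. -/
def IsSmoothSection {G M : Type*} [Group G] [TopologicalSpace M] [ChartedSpace EM M] [MulAction G M]
    (n : ℕ) [ChartedSpace (EuclideanSpace ℝ (Fin n)) (MulAction.orbitRel.Quotient G M)]
    (s : MulAction.orbitRel.Quotient G M → M) : Prop :=
  ContMDiff (𝓡 n) 𝓘(ℝ, EM) ∞ s ∧ ∀ y, orbitProj G M (s y) = y

/-- `Vq` is the reduced field on `M/G`: `Vq(π(p)) = dπ (V(p))` for all `p`. -/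
def IsReducedField {G M : Type*} [Group G] [TopologicalSpace M] [ChartedSpace EM M] [MulAction G M]
    (n : ℕ) [ChartedSpace (EuclideanSpace ℝ (Fin n)) (MulAction.orbitRel.Quotient G M)]
    (V : ∀ p : M, TangentSpace 𝓘(ℝ, EM) p)
    (Vq : ∀ y : MulAction.orbitRel.Quotient G M, TangentSpace (𝓡 n) y) : Prop :=
  ∀ p : M, Vq (orbitProj G M p) = mfderiv 𝓘(ℝ, EM) (𝓡 n) (orbitProj G M) p (V p)

/-- `Vhat(y) = (dΦ^{s(y)})⁻¹ (V(s(y)) - ds (Vq(y)))`, where `Φ^p : G → M`, `g ↦ g • p`, and the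
differential is taken at the identity: `dΦ^{s(y)}` is injective on the Lie algebra, and
`Vhat(y)` is the (hence unique) preimage of `V(s(y)) - ds (Vq(y))`. -/
def IsForcingTerm {G M : Type*} [TopologicalSpace G] [ChartedSpace EG G] [Group G]
    [TopologicalSpace M] [ChartedSpace EM M] [MulAction G M]
    (n : ℕ) [ChartedSpace (EuclideanSpace ℝ (Fin n)) (MulAction.orbitRel.Quotient G M)]
    (s : MulAction.orbitRel.Quotient G M → M)
    (V : ∀ p : M, TangentSpace 𝓘(ℝ, EM) p)
    (Vq : ∀ y : MulAction.orbitRel.Quotient G M, TangentSpace (𝓡 n) y)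
    (Vhat : MulAction.orbitRel.Quotient G M → GroupLieAlgebra 𝓘(ℝ, EG) G) : Prop :=
  ∀ y, Function.Injective (mfderiv 𝓘(ℝ, EG) 𝓘(ℝ, EM) (fun g : G => g • s y) 1) ∧
    mfderiv 𝓘(ℝ, EG) 𝓘(ℝ, EM) (fun g : G => g • s y) 1 (Vhat y) =
      (V (s y) - mfderiv (𝓡 n) 𝓘(ℝ, EM) s y (Vq y) : TangentSpace 𝓘(ℝ, EM) (s y))

end Actions

end

/-! Slices. If `v` is in the kernel of the differential at `1` of `g ↦ g • p`, then the integral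
curve of the left-invariant field of `v` moves `p` with zero velocity, so by freeness it stays at
`1` and `v = 0`. Hence `(x, a) ↦ γ a • σ x`, with `γ` an inverse chart of `G` at `1` and `σ` a slice
transverse to the orbit, is a local diffeomorphism at `0`. Properness allows only `g` near `1` to
move points near `p` to points near `p`; so, after shrinking, the slice meets each orbit at most
once, and `x` is a coordinate on the orbit space in which `π` is a linear projection
(`nonempty_sliceChart`, `isSubmersion_orbitProj`).

Reduction. A section `s` defines `θ : M → G` by `θ q • s (π q) = q`. Slices show that `θ` is smooth,
whichever admissible structure `M/G` carries (`contMDiff_groupComponent`). Differentiating this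
identity splits tangent vectors into an orbit part and a section part. Weak invariance makes `dπ V`
constant along orbits, and injectivity of the orbit maps' differentials then gives `dθ V = W + dL
V̂` (`modelDeriv_groupComponent_apply`). Along an integral curve `p`, necessarily `y = π ∘ p` and `g
= θ ∘ p`, so the cascade is the chain rule. Group affinity is algebraic: the contribution of the
left-invariant term under right translation cancels the correction at `e`. -/

open scoped Topology

/-! ### Derivatives between model spaces -/

section ModelDerivative

variable {E E' E'' : Type*} [NormedAddCommGroup E] [NormedSpace ℝ E] [NormedAddCommGroup E']
  [NormedSpace ℝ E'] [NormedAddCommGroup E''] [NormedSpace ℝ E'']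
  {M M' M'' : Type*} [TopologicalSpace M] [ChartedSpace E M] [TopologicalSpace M']
  [ChartedSpace E' M'] [TopologicalSpace M''] [ChartedSpace E'' M'']

/-- The manifold derivative of a map between boundaryless manifolds, seen as a map between the
model spaces. This avoids transports between tangent spaces at propositionally equal points. -/
noncomputable def modelDeriv (E E' : Type*) [NormedAddCommGroup E] [NormedSpace ℝ E]
    [NormedAddCommGroup E'] [NormedSpace ℝ E'] {M M' : Type*} [TopologicalSpace M]
    [ChartedSpace E M] [TopologicalSpace M'] [ChartedSpace E' M'] (f : M → M') (x : M) :
    E →L[ℝ] E' :=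
  mfderiv 𝓘(ℝ, E) 𝓘(ℝ, E') f x

/-- The base point `y` is tied to `f x` only by an equation, so the outer derivative can be taken at
`g` or `p` when `f x` is literally `g * 1` or `1 • p`. -/
theorem modelDeriv_comp {g : M' → M''} {f : M → M'} {x : M} {y : M'}
    (hg : MDifferentiableAt 𝓘(ℝ, E') 𝓘(ℝ, E'') g y) (hf : MDifferentiableAt 𝓘(ℝ, E) 𝓘(ℝ, E') f x)
    (hy : f x = y) :
    modelDeriv E E'' (g ∘ f) x = (modelDeriv E' E'' g y).comp (modelDeriv E E' f x) := by
  subst hy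
  exact mfderiv_comp x hg hf

theorem modelDeriv_comp_apply {g : M' → M''} {f : M → M'} {x : M} {y : M'}
    (hg : MDifferentiableAt 𝓘(ℝ, E') 𝓘(ℝ, E'') g y) (hf : MDifferentiableAt 𝓘(ℝ, E) 𝓘(ℝ, E') f x)
    (hy : f x = y) (v : E) :
    modelDeriv E E'' (fun z => g (f z)) x v = modelDeriv E' E'' g y (modelDeriv E E' f x v) :=
  DFunLike.congr_fun (modelDeriv_comp hg hf hy) v

theorem modelDeriv_id (x : M) : modelDeriv E E (fun z : M => z) x = ContinuousLinearMap.id ℝ E :=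
  mfderiv_id

theorem modelDeriv_const (x : M) (y : M') : modelDeriv E E' (fun _ : M => y) x = 0 :=
  mfderiv_const

/-- The derivative of a map of two variables is the sum of the partial derivatives. -/
theorem mfderiv_prod_apply_eq_modelDeriv {f : M × M' → M''} {x : M} {y : M'}
    (hf : MDifferentiableAt (𝓘(ℝ, E).prod 𝓘(ℝ, E')) 𝓘(ℝ, E'') f (x, y)) (v : E) (w : E') :
    (mfderiv (𝓘(ℝ, E).prod 𝓘(ℝ, E')) 𝓘(ℝ, E'') f (x, y) ((v, w) : E × E') : E'') =
      modelDeriv E E'' (fun z => f (z, y)) x v + modelDeriv E' E'' (fun z => f (x, z)) y w :=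
  mfderiv_prod_eq_add_apply (I := 𝓘(ℝ, E)) (I' := 𝓘(ℝ, E')) (I'' := 𝓘(ℝ, E''))
    (p := (x, y)) (v := ((v, w) : E × E')) hf

/-- Chain rule for a map of two variables. -/
theorem modelDeriv_comp₂_apply {N F : Type*} [NormedAddCommGroup F] [NormedSpace ℝ F]
    [TopologicalSpace N] [ChartedSpace F N] {f : M × M' → M''} {a : N → M} {b : N → M'} {z : N}
    {x : M} {y : M'} (hf : MDifferentiableAt (𝓘(ℝ, E).prod 𝓘(ℝ, E')) 𝓘(ℝ, E'') f (x, y))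
    (ha : MDifferentiableAt 𝓘(ℝ, F) 𝓘(ℝ, E) a z) (hb : MDifferentiableAt 𝓘(ℝ, F) 𝓘(ℝ, E') b z)
    (hx : a z = x) (hy : b z = y) (v : F) :
    modelDeriv F E'' (fun t => f (a t, b t)) z v =
      modelDeriv E E'' (fun t => f (t, y)) x (modelDeriv F E a z v) +
        modelDeriv E' E'' (fun t => f (x, t)) y (modelDeriv F E' b z v) := by
  subst hx hy
  have h := (hf.hasMFDerivAt.comp z (ha.hasMFDerivAt.prodMk hb.hasMFDerivAt)).mfderiv
  have h' : modelDeriv F E'' (fun t => f (a t, b t)) z v =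
    (mfderiv (𝓘(ℝ, E).prod 𝓘(ℝ, E')) 𝓘(ℝ, E'') f (a z, b z)
      ((modelDeriv F E a z v, modelDeriv F E' b z v) : E × E') : E'') := DFunLike.congr_fun h v
  rw [h', mfderiv_prod_apply_eq_modelDeriv hf]

end ModelDerivative

/-! ### Left-invariant, group linear and group affine fields -/

section InvariantFields

variable {EG : Type*} [NormedAddCommGroup EG] [NormedSpace ℝ EG]
  {G : Type*} [TopologicalSpace G] [ChartedSpace EG G] [Group G]

/-- The left-invariant field with value `v` at the identity, with values in the model space. -/
noncomputable def leftInvariantField (G : Type*) [TopologicalSpace G] [ChartedSpace EG G] [Group G]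
    (v : EG) (g : G) : EG :=
  modelDeriv EG EG (fun x : G => g * x) 1 v

theorem leftInvariantField_one (v : EG) : leftInvariantField G v 1 = v := by
  have h : (fun x : G => (1 : G) * x) = fun x => x := by ext x; simp
  rw [leftInvariantField, h, modelDeriv_id]; rfl

variable [LieGroup 𝓘(ℝ, EG) ∞ G]

variable (EG) in
theorem mdifferentiable_leftTranslation (g : G) :
    MDifferentiable 𝓘(ℝ, EG) 𝓘(ℝ, EG) (fun x : G => g * x) :=
  (contMDiff_mul_left (I := 𝓘(ℝ, EG)) (n := ∞)).mdifferentiable (by simp)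

variable (EG) in
theorem mdifferentiable_rightTranslation (h : G) :
    MDifferentiable 𝓘(ℝ, EG) 𝓘(ℝ, EG) (fun x : G => x * h) :=
  (contMDiff_mul_right (I := 𝓘(ℝ, EG)) (n := ∞)).mdifferentiable (by simp)

/-- Left-invariant vector fields on a smooth Lie group are smooth. -/
theorem isSmoothVectorField_mulInvariantVectorField (v : GroupLieAlgebra 𝓘(ℝ, EG) G) :
    IsSmoothVectorField (mulInvariantVectorField v : ∀ g : G, TangentSpace 𝓘(ℝ, EG) g) := by
  -- The field is the tangent map of multiplication evaluated at the pair of the zero vector at `g`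
  -- and `v` at `1`, hence a composite of smooth maps.
  have sfg : ContMDiff 𝓘(ℝ, EG) 𝓘(ℝ, EG).tangent ∞
      (fun g : G => (⟨g, 0⟩ : TangentBundle 𝓘(ℝ, EG) G)) := Bundle.contMDiff_zeroSection _ _
  have sfv : ContMDiff 𝓘(ℝ, EG) 𝓘(ℝ, EG).tangent ∞
      (fun _ : G => (⟨1, v⟩ : TangentBundle 𝓘(ℝ, EG) G)) := contMDiff_const
  have S₂ : ContMDiff (𝓘(ℝ, EG).tangent.prod 𝓘(ℝ, EG).tangent) (𝓘(ℝ, EG).prod 𝓘(ℝ, EG)).tangent ∞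
      (equivTangentBundleProd 𝓘(ℝ, EG) G 𝓘(ℝ, EG) G).symm := contMDiff_equivTangentBundleProd_symm
  have hmul : ContMDiff (𝓘(ℝ, EG).prod 𝓘(ℝ, EG)) 𝓘(ℝ, EG) ∞ (fun p : G × G => p.1 * p.2) :=
    contMDiff_mul 𝓘(ℝ, EG) ∞
  refine (((hmul.contMDiff_tangentMap (m := ∞) le_rfl).comp S₂).comp (sfg.prodMk sfv)).congr
    fun g => ?_
  have key (w : EG) : (mfderiv (𝓘(ℝ, EG).prod 𝓘(ℝ, EG)) 𝓘(ℝ, EG) (fun p : G × G => p.1 * p.2)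
      (g, 1) (((0 : EG), w) : EG × EG) : EG) = leftInvariantField G w g := by
    rw [mfderiv_prod_apply_eq_modelDeriv (hmul.mdifferentiable (by simp) (g, 1)), map_zero,
      zero_add]
    rfl
  show (⟨g, mulInvariantVectorField v g⟩ : TangentBundle 𝓘(ℝ, EG) G) =
    ⟨g * 1, mfderiv (𝓘(ℝ, EG).prod 𝓘(ℝ, EG)) 𝓘(ℝ, EG) (fun p : G × G => p.1 * p.2) (g, 1)
      (((0 : EG), (v : EG)) : EG × EG)⟩
  -- The fibres over `g` and `g * 1` are both the model space by definition, so an equality there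
  -- suffices.
  exact Bundle.TotalSpace.ext (mul_one g).symm (heq_of_eq (key v).symm)

theorem leftInvariantField_mul (v : EG) (g h : G) :
    leftInvariantField G v (g * h) =
      modelDeriv EG EG (fun x : G => g * x) h (leftInvariantField G v h) := by
  have hc : (fun x : G => g * h * x) = fun x : G => g * (h * x) := by
    ext x; simp [mul_assoc]
  rw [leftInvariantField, hc]
  exact modelDeriv_comp_apply (mdifferentiable_leftTranslation EG g h)
    (mdifferentiable_leftTranslation EG h 1) (mul_one h) _

/-- Left and right translations commute: both sides differentiate `x ↦ g * x * h` at `1`. -/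
theorem modelDeriv_rightTranslation_leftInvariantField (v : EG) (g h : G) :
    modelDeriv EG EG (fun x : G => x * h) g (leftInvariantField G v g) =
      modelDeriv EG EG (fun x : G => g * x) h (modelDeriv EG EG (fun x : G => x * h) 1 v) := by
  have h1 := modelDeriv_comp_apply (mdifferentiable_rightTranslation EG h g)
    (mdifferentiable_leftTranslation EG g 1) (mul_one g) v
  have h2 := modelDeriv_comp_apply (mdifferentiable_leftTranslation EG g h)
    (mdifferentiable_rightTranslation EG h 1) (one_mul h) v
  simp_rw [mul_assoc] at h1
  exact h1.symm.trans h2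

theorem IsGroupLinear.map_one {W : ∀ g : G, TangentSpace 𝓘(ℝ, EG) g} (hW : IsGroupLinear W) :
    (W 1 : EG) = 0 := by
  have h : (W (1 * 1) : EG) = modelDeriv EG EG (fun x : G => 1 * x) 1 (W 1) +
    modelDeriv EG EG (fun x : G => x * 1) 1 (W 1) := hW.2 1 1
  simp_rw [one_mul, mul_one, modelDeriv_id] at h
  have h3 : (W (1 * 1) : EG) = W 1 := by rw [mul_one]
  exact left_eq_add.mp (h3.symm.trans h)

/-- A group linear field plus a left-invariant field is group affine. -/
theorem IsGroupLinear.isGroupAffine_add {W : ∀ g : G, TangentSpace 𝓘(ℝ, EG) g}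
    (hW : IsGroupLinear W) (v : GroupLieAlgebra 𝓘(ℝ, EG) G) :
    IsGroupAffine (fun g : G => W g + mulInvariantVectorField v g) := by
  refine ⟨ContMDiff.add_section hW.1 (isSmoothVectorField_mulInvariantVectorField v),
    fun g h => ?_⟩
  have key (w : G → EG) (u : EG) (h1 : w 1 = 0)
      (hw : w (g * h) = modelDeriv EG EG (fun x : G => g * x) h (w h) +
        modelDeriv EG EG (fun x : G => x * h) g (w g)) :
      w (g * h) + leftInvariantField G u (g * h) =
        modelDeriv EG EG (fun x : G => g * x) h (w h + leftInvariantField G u h) +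
        modelDeriv EG EG (fun x : G => x * h) g (w g + leftInvariantField G u g) -
        modelDeriv EG EG (fun x : G => g * x) h
          (modelDeriv EG EG (fun x : G => x * h) 1 (w 1 + leftInvariantField G u 1)) := by
    -- Since `w 1 = 0`, the correction term involves `u` alone and equals the right translate of the
    -- left-invariant field, so the two cancel.
    rw [h1, zero_add, leftInvariantField_one, map_add, map_add, leftInvariantField_mul,
      modelDeriv_rightTranslation_leftInvariantField, hw]
    abel
  exact key W v hW.map_one (hW.2 g h)

end InvariantFields

section Translations

variable (EG EM : Type*) [NormedAddCommGroup EG] [NormedSpace ℝ EG]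
  [NormedAddCommGroup EM] [NormedSpace ℝ EM]
  {G : Type*} (M : Type*) [TopologicalSpace G] [ChartedSpace EG G] [Group G]
  [TopologicalSpace M] [ChartedSpace EM M] [MulAction G M]

theorem contMDiff_translation [ContMDiffSMul 𝓘(ℝ, EG) 𝓘(ℝ, EM) ∞ G M] (g : G) :
    ContMDiff 𝓘(ℝ, EM) 𝓘(ℝ, EM) ∞ (fun p : M => g • p) :=
  (ContMDiffSMul.contMDiff_smul (I := 𝓘(ℝ, EG))).comp (contMDiff_const.prodMk contMDiff_id)

theorem mdifferentiable_translation [ContMDiffSMul 𝓘(ℝ, EG) 𝓘(ℝ, EM) ∞ G M] (g : G) :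
    MDifferentiable 𝓘(ℝ, EM) 𝓘(ℝ, EM) (fun p : M => g • p) :=
  (contMDiff_translation EG EM M g).mdifferentiable (by simp)

end Translations

/-! ### Orbit maps of a free action are immersions -/

section OrbitMaps

variable {EG EM : Type*} [NormedAddCommGroup EG] [NormedSpace ℝ EG]
  [NormedAddCommGroup EM] [NormedSpace ℝ EM]
  {G M : Type*} [TopologicalSpace G] [ChartedSpace EG G] [Group G]
  [TopologicalSpace M] [ChartedSpace EM M]
  [MulAction G M] [ContMDiffSMul 𝓘(ℝ, EG) 𝓘(ℝ, EM) ∞ G M]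

variable (EG EM G M) in
theorem contMDiff_action : ContMDiff (𝓘(ℝ, EG).prod 𝓘(ℝ, EM)) 𝓘(ℝ, EM) ∞
    (fun q : G × M => q.1 • q.2) := ContMDiffSMul.contMDiff_smul

variable (EG EM G M) in
theorem mdifferentiable_action : MDifferentiable (𝓘(ℝ, EG).prod 𝓘(ℝ, EM)) 𝓘(ℝ, EM)
    (fun q : G × M => q.1 • q.2) := (contMDiff_action EG EM G M).mdifferentiable (by simp)

variable (EG EM) in
theorem contMDiff_orbitMap (p : M) : ContMDiff 𝓘(ℝ, EG) 𝓘(ℝ, EM) ∞ (fun g : G => g • p) :=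
  (contMDiff_action EG EM G M).comp (contMDiff_id.prodMk contMDiff_const)

variable (EG EM) in
theorem mdifferentiable_orbitMap (p : M) :
    MDifferentiable 𝓘(ℝ, EG) 𝓘(ℝ, EM) (fun g : G => g • p) :=
  (contMDiff_orbitMap EG EM p).mdifferentiable (by simp)

variable [LieGroup 𝓘(ℝ, EG) ∞ G]

/-- Along a left-invariant field, the differential of an orbit map is the translate of its
differential at the identity. -/
theorem modelDeriv_orbitMap_leftInvariantField (p : M) (g : G) (v : EG) :
    modelDeriv EG EM (fun g : G => g • p) g (leftInvariantField G v g) =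
      modelDeriv EM EM (fun q : M => g • q) p (modelDeriv EG EM (fun g : G => g • p) 1 v) := by
  have h1 := modelDeriv_comp_apply (mdifferentiable_orbitMap EG EM p g)
    (mdifferentiable_leftTranslation EG g 1) (mul_one g) v
  have h2 := modelDeriv_comp_apply (mdifferentiable_translation EG EM M g p)
    (mdifferentiable_orbitMap EG EM p 1) (one_smul G p) v
  simp_rw [mul_smul] at h1
  exact h1.symm.trans h2

variable [IsManifold 𝓘(ℝ, EM) ∞ M]

/-- A curve in a manifold with vanishing derivative is locally constant. -/
theorem eventually_eq_of_hasMFDerivAt_zero {M : Type*} [TopologicalSpace M] [ChartedSpace EM M]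
    [IsManifold 𝓘(ℝ, EM) ∞ M] {γ : ℝ → M} {t₀ : ℝ}
    (h : ∀ᶠ t in 𝓝 t₀, HasMFDerivAt 𝓘(ℝ, ℝ) 𝓘(ℝ, EM) γ t (0 : ℝ →L[ℝ] EM)) :
    ∀ᶠ t in 𝓝 t₀, γ t = γ t₀ := by
  set c := chartAt EM (γ t₀)
  have hsrc : ∀ᶠ t in 𝓝 t₀, γ t ∈ c.source :=
    h.self_of_nhds.continuousAt.eventually_mem (c.open_source.mem_nhds (mem_chart_source EM _))
  obtain ⟨ε, hε, hball⟩ := Metric.eventually_nhds_iff_ball.1 (h.and hsrc)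
  filter_upwards [Metric.ball_mem_nhds t₀ hε] with t ht
  have hd : ∀ u ∈ Metric.ball t₀ ε, HasFDerivAt (fun t => c (γ t)) (0 : ℝ →L[ℝ] EM) u := by
    intro u hu
    have h1 : MDifferentiableAt 𝓘(ℝ, EM) 𝓘(ℝ, EM) c (γ u) :=
      (contMDiffAt_of_mem_maximalAtlas (n := ∞)
        (IsManifold.chart_mem_maximalAtlas (I := 𝓘(ℝ, EM)) (γ t₀)) (hball u hu).2).mdifferentiableAt
        (by simp)
    refine (h1.hasMFDerivAt.comp u (hball u hu).1).hasFDerivAt.congr_fderiv ?_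
    exact ContinuousLinearMap.comp_zero (modelDeriv EM EM c (γ u))
  have heq := (convex_ball t₀ ε).is_const_of_fderivWithin_eq_zero (𝕜 := ℝ)
    (f := fun t => c (γ t))
    (fun u hu => (hd u hu).differentiableAt.differentiableWithinAt)
    (fun u hu => ((hd u hu).hasFDerivWithinAt.fderivWithin
      (Metric.isOpen_ball.uniqueDiffWithinAt hu))) ht (Metric.mem_ball_self hε)
  exact c.injOn (hball t ht).2 (hball t₀ (Metric.mem_ball_self hε)).2 heq

/-- The orbit maps of a free smooth action have injective differential at the identity. -/
theorem modelDeriv_orbitMap_one_injective [CompleteSpace EG]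
    (hfree : ∀ (g : G) (p : M), g • p = p → g = 1) (p : M) :
    Function.Injective (modelDeriv EG EM (fun g : G => g • p) 1) := by
  refine (injective_iff_map_eq_zero _).2 fun v hv => ?_
  have : IsManifold 𝓘(ℝ, EG) 1 G := IsManifold.of_le (n := ∞) (by simp)
  -- `γ` integrates the left-invariant field of `v` from `1`; the velocity of `γ t • p` is a
  -- translate of the image of `v`, which is zero.
  obtain ⟨γ, hγ0, hγ⟩ := exists_isMIntegralCurveAt_of_contMDiffAt_boundaryless (t₀ := 0)
    (v := (mulInvariantVectorField v : ∀ g : G, TangentSpace 𝓘(ℝ, EG) g)) (x₀ := 1)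
    ((ContMDiff.of_le (isSmoothVectorField_mulInvariantVectorField (G := G) v)
      (by simp)).contMDiffAt)
  have hc : ∀ᶠ t in 𝓝 (0 : ℝ), HasMFDerivAt 𝓘(ℝ, ℝ) 𝓘(ℝ, EM) (fun t => γ t • p) t
      (0 : ℝ →L[ℝ] EM) := by
    filter_upwards [hγ] with t ht
    have h := (mdifferentiable_orbitMap EG EM p (γ t)).hasMFDerivAt.comp t ht
    refine h.congr_mfderiv ?_
    refine ContinuousLinearMap.ext fun r => ?_
    show modelDeriv EG EM (fun g : G => g • p) (γ t) ((show ℝ from r) • leftInvariantField G v (γ t)) = 0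
    rw [map_smul, modelDeriv_orbitMap_leftInvariantField, hv, map_zero, smul_zero]
  have hγ1 : γ =ᶠ[𝓝 0] fun _ => 1 := by
    filter_upwards [eventually_eq_of_hasMFDerivAt_zero hc] with t ht
    exact hfree _ _ (by simpa [hγ0] using ht)
  have hz := hasMFDerivAt_unique hγ.self_of_nhds
    ((hasMFDerivAt_const (I := 𝓘(ℝ, ℝ)) (I' := 𝓘(ℝ, EG)) (1 : G) (0 : ℝ)).congr_of_eventuallyEq
      hγ1)
  have hz' : (1 : ℝ) • leftInvariantField G v (γ 0) = 0 := DFunLike.congr_fun hz (1 : ℝ)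
  rwa [one_smul, hγ0, leftInvariantField_one] at hz'

/-- Equivariance moves the question from `g` back to `1`: a kernel vector is killed by left
translation by `g⁻¹`, which is invertible. -/
theorem modelDeriv_orbitMap_injective [CompleteSpace EG]
    (hfree : ∀ (g : G) (p : M), g • p = p → g = 1) (p : M) (g : G) :
    Function.Injective (modelDeriv EG EM (fun g : G => g • p) g) := by
  refine (injective_iff_map_eq_zero _).2 fun v hv => ?_
  have h1 := modelDeriv_comp_apply (mdifferentiable_orbitMap EG EM p 1)
    (mdifferentiable_leftTranslation EG g⁻¹ g) (inv_mul_cancel g) v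
  have h2 := modelDeriv_comp_apply (mdifferentiable_translation EG EM M g⁻¹ (g • p))
    (mdifferentiable_orbitMap EG EM p g) rfl v
  simp_rw [mul_smul] at h1
  rw [h2, hv, map_zero] at h1
  have h3 := modelDeriv_orbitMap_one_injective hfree p (h1.symm.trans (map_zero _).symm)
  have h4 := modelDeriv_comp_apply (mdifferentiable_leftTranslation EG g 1)
    (mdifferentiable_leftTranslation EG g⁻¹ g) (inv_mul_cancel g) v
  simp_rw [mul_inv_cancel_left, modelDeriv_id] at h4
  erw [h3, map_zero] at h4
  exact h4

end OrbitMaps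

/-! ### Inverse function theorem and linear complements -/

section InverseFunction

/-- The inverse function theorem for a map that is smooth on an open set, with an inverse that is
smooth on an open set. -/
theorem exists_openPartialHomeomorph_contDiffOn_symm {E F : Type*} [NormedAddCommGroup E]
    [NormedSpace ℝ E] [CompleteSpace E] [NormedAddCommGroup F] [NormedSpace ℝ F] {f : E → F}
    {O : Set E} (hO : IsOpen O) (hf : ContDiffOn ℝ ∞ f O) {x : E} (hx : x ∈ O) (A : E ≃L[ℝ] F)
    (hA : HasFDerivAt f (A : E →L[ℝ] F) x) :
    ∃ φ : OpenPartialHomeomorph E F, (φ : E → F) = f ∧ x ∈ φ.source ∧ φ.source ⊆ O ∧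
      ContDiffOn ℝ ∞ φ.symm φ.target := by
  have hfx : ContDiffAt ℝ ∞ f x := hf.contDiffAt (hO.mem_nhds hx)
  set ψ := hfx.toOpenPartialHomeomorph f hA (by simp) with hψ
  -- Restricting to the open set where the derivative is invertible makes the local inverse smooth
  -- on its whole target, not just at `f x`.
  set O' : Set E := O ∩ fderiv ℝ f ⁻¹' Set.range ((↑) : (E ≃L[ℝ] F) → E →L[ℝ] F) with hO'
  have hO'open : IsOpen O' :=
    (hf.continuousOn_fderiv_of_isOpen hO (by simp)).isOpen_inter_preimage hO
      ContinuousLinearEquiv.isOpen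
  have hxO' : x ∈ O' := ⟨hx, A, hA.fderiv.symm⟩
  refine ⟨ψ.restr O', rfl, ⟨hfx.mem_toOpenPartialHomeomorph_source hA (by simp), ?_⟩, ?_, ?_⟩
  · simpa [hO'open.interior_eq] using hxO'
  · intro z hz
    rw [ψ.restr_source' _ hO'open] at hz
    exact hz.2.1
  · intro y hy
    have hz := (ψ.restr O').map_target hy
    rw [ψ.restr_source' _ hO'open] at hz
    obtain ⟨hz1, hz2, B, hB⟩ := hz
    have hsm : ContDiffAt ℝ ∞ f (ψ.symm y) := hf.contDiffAt (hO.mem_nhds hz2)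
    refine (ψ.contDiffAt_symm (f₀' := B) hy.1 ?_ hsm).contDiffWithinAt
    rw [hB]
    exact (hsm.differentiableAt (by simp)).hasFDerivAt

/-- An injective linear map extends to a linear isomorphism on the product with a Euclidean
space. -/
theorem exists_continuousLinearEquiv_extending {E F : Type*} [NormedAddCommGroup E]
    [NormedSpace ℝ E] [FiniteDimensional ℝ E] [NormedAddCommGroup F] [NormedSpace ℝ F]
    [FiniteDimensional ℝ F] (D : E →L[ℝ] F) (hD : Function.Injective D) :
    ∃ A : (EuclideanSpace ℝ (Fin (Module.finrank ℝ F - Module.finrank ℝ E)) × E) ≃L[ℝ] F,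
      ∀ a, A (0, a) = D a := by
  obtain ⟨K, hK⟩ := Submodule.exists_isCompl (LinearMap.range (D : E →ₗ[ℝ] F))
  have h1 : Module.finrank ℝ (LinearMap.range (D : E →ₗ[ℝ] F)) = Module.finrank ℝ E :=
    LinearMap.finrank_range_of_inj hD
  have h2 := Submodule.finrank_add_eq_of_isCompl hK
  have h3 : Module.finrank ℝ (EuclideanSpace ℝ (Fin (Module.finrank ℝ F - Module.finrank ℝ E))) =
      -- The natural-number subtraction is not truncated: by `h1` and `h2` the ranks of `E` and `K`
      -- add up to that of `F`.
      Module.finrank ℝ K := by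
    rw [finrank_euclideanSpace_fin]; omega
  let e1 : EuclideanSpace ℝ (Fin (Module.finrank ℝ F - Module.finrank ℝ E)) ≃ₗ[ℝ] K :=
    LinearEquiv.ofFinrankEq _ _ h3
  let e2 : E ≃ₗ[ℝ] LinearMap.range (D : E →ₗ[ℝ] F) := LinearEquiv.ofInjective _ hD
  let e := (e1.prodCongr e2).trans (Submodule.prodEquivOfIsCompl K _ hK.symm)
  refine ⟨e.toContinuousLinearEquiv, fun a => ?_⟩
  show ((e1 0 : K) : F) + (e2 a : F) = D a
  simp [e2]

end InverseFunction

/-! ### Slices for free proper actions -/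

/-- A proper free action moves points near `p` to points near `p` only by group elements near the
identity. -/
theorem exists_nhds_smul_mem_imp {G M : Type*} [TopologicalSpace G] [Group G] [TopologicalSpace M]
    [MulAction G M] [ProperSMul G M] (hfree : ∀ (g : G) (p : M), g • p = p → g = 1) (p : M)
    {N : Set G} (hN : N ∈ 𝓝 1) :
    ∃ V ∈ 𝓝 p, ∀ q ∈ V, ∀ g : G, g • q ∈ V → g ∈ N := by
  -- Proper maps are closed, so the pairs `(g • q, q)` with `g` outside `interior N` form a closed
  -- set. Freeness keeps `(p, p)` out of it, so a square `V × V` around `(p, p)` avoids it.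
  have hC : IsClosed ((fun gx : G × M => (gx.1 • gx.2, gx.2)) '' ((interior N)ᶜ ×ˢ Set.univ)) :=
    ProperSMul.isProperMap_smul_pair.isClosedMap _
      (isOpen_interior.isClosed_compl.prod isClosed_univ)
  have hp : (p, p) ∉ (fun gx : G × M => (gx.1 • gx.2, gx.2)) '' ((interior N)ᶜ ×ˢ Set.univ) := by
    rintro ⟨⟨g, q⟩, ⟨hg, -⟩, h⟩
    simp only [Prod.mk.injEq] at h
    obtain ⟨h1, rfl⟩ := h
    exact hg (hfree _ _ h1 ▸ mem_interior_iff_mem_nhds.2 hN)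
  have h := hC.isOpen_compl.mem_nhds hp
  rw [nhds_prod_eq] at h
  obtain ⟨V, hV, h⟩ := Filter.mem_prod_same_iff.1 h
  refine ⟨V, hV, fun q hq g hg => ?_⟩
  by_contra hgN
  exact h (Set.mk_mem_prod hg hq)
    ⟨(g, q), ⟨fun hg' => hgN (interior_subset hg'), Set.mem_univ _⟩, rfl⟩

/-- A slice chart at `p`: coordinates `(x, a)` on a neighbourhood of `p` in which `x` parametrizes
the orbits near `p` and `a` the position along the orbit. -/
structure SliceChart (EG EM : Type*) [NormedAddCommGroup EG] [NormedSpace ℝ EG]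
    [NormedAddCommGroup EM] [NormedSpace ℝ EM] (G : Type*) {M : Type*} [TopologicalSpace G]
    [ChartedSpace EG G] [Group G] [TopologicalSpace M] [ChartedSpace EM M] [MulAction G M]
    (n : ℕ) (p : M) where
  chart : OpenPartialHomeomorph M (EuclideanSpace ℝ (Fin n) × EG)
  model : (EuclideanSpace ℝ (Fin n) × EG) ≃L[ℝ] EM
  base : Set (EuclideanSpace ℝ (Fin n))
  fiber : Set EG
  shift : EG → G
  isOpen_base : IsOpen base
  isOpen_fiber : IsOpen fiber
  zero_mem_fiber : 0 ∈ fiber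
  target_eq : chart.target = base ×ˢ fiber
  mem_source : p ∈ chart.source
  contMDiffOn_chart : ContMDiffOn 𝓘(ℝ, EM) 𝓘(ℝ, EuclideanSpace ℝ (Fin n) × EG) ∞ chart chart.source
  contMDiffOn_symm : ContMDiffOn 𝓘(ℝ, EuclideanSpace ℝ (Fin n) × EG) 𝓘(ℝ, EM) ∞ chart.symm
    chart.target
  contMDiffOn_shift : ContMDiffOn 𝓘(ℝ, EG) 𝓘(ℝ, EG) ∞ shift fiber
  symm_apply : ∀ x ∈ base, ∀ a ∈ fiber, chart.symm (x, a) = shift a • chart.symm (x, 0)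
  rigid : ∀ x ∈ base, ∀ x' ∈ base, ∀ g : G, g • chart.symm (x, 0) = chart.symm (x', 0) →
    g = 1 ∧ x = x'

section Slices

variable {EG EM : Type*} [NormedAddCommGroup EG] [NormedSpace ℝ EG] [FiniteDimensional ℝ EG]
  [NormedAddCommGroup EM] [NormedSpace ℝ EM] [FiniteDimensional ℝ EM]
  {G M : Type*} [TopologicalSpace G] [ChartedSpace EG G] [Group G] [LieGroup 𝓘(ℝ, EG) ∞ G]
  [TopologicalSpace M] [ChartedSpace EM M] [IsManifold 𝓘(ℝ, EM) ∞ M]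
  [MulAction G M] [ContMDiffSMul 𝓘(ℝ, EG) 𝓘(ℝ, EM) ∞ G M] [ProperSMul G M]

/-- The inverse function theorem gives the coordinates; properness is needed for `rigid`, since an
orbit could otherwise return to the slice by a group element far from `1`. -/
theorem nonempty_sliceChart (hfree : ∀ (g : G) (p : M), g • p = p → g = 1) (p : M) :
    Nonempty (SliceChart EG EM G (Module.finrank ℝ EM - Module.finrank ℝ EG) p) := by
  have : CompleteSpace EG := FiniteDimensional.complete ℝ EG
  set n := Module.finrank ℝ EM - Module.finrank ℝ EG
  set e := chartAt EG (1 : G) with he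
  set c := chartAt EM p with hc
  obtain ⟨A, hA⟩ := exists_continuousLinearEquiv_extending
    (modelDeriv EG EM (fun g : G => g • p) 1) (modelDeriv_orbitMap_one_injective hfree p)
  set γ : EG → G := fun a => e.symm (e 1 + a) with hγ
  set σ : EuclideanSpace ℝ (Fin n) → M := fun x => c.symm (c p + A (x, 0)) with hσ
  have hγ0 : γ 0 = 1 := by simp [hγ, he]
  have hσ0 : σ 0 = p := by
    have : A (0 : EuclideanSpace ℝ (Fin n) × EG) = 0 := map_zero A
    have h0 : A ((0 : EuclideanSpace ℝ (Fin n)), (0 : EG)) = 0 := this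
    simp [hσ, hc, h0]
  set Γ : Set EG := (fun a => e 1 + a) ⁻¹' e.target with hΓ
  set S : Set (EuclideanSpace ℝ (Fin n)) := (fun x => c p + A (x, 0)) ⁻¹' c.target with hS
  have hΓo : IsOpen Γ := e.open_target.preimage (by fun_prop)
  have hSo : IsOpen S := c.open_target.preimage (by fun_prop)
  have hγs : ContMDiffOn 𝓘(ℝ, EG) 𝓘(ℝ, EG) ∞ γ Γ :=
    (contMDiffOn_chart_symm (I := 𝓘(ℝ, EG)) (n := ∞)).comp
      (ContDiff.contMDiff (by fun_prop)).contMDiffOn (fun a ha => ha)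
  have hσs : ContMDiffOn 𝓘(ℝ, EuclideanSpace ℝ (Fin n)) 𝓘(ℝ, EM) ∞ σ S :=
    (contMDiffOn_chart_symm (I := 𝓘(ℝ, EM)) (n := ∞)).comp
      (ContDiff.contMDiff (by fun_prop)).contMDiffOn (fun a ha => ha)
  set Ψ : EuclideanSpace ℝ (Fin n) × EG → M := fun z => γ z.2 • σ z.1 with hΨ
  have hΨs : ContMDiffOn 𝓘(ℝ, EuclideanSpace ℝ (Fin n) × EG) 𝓘(ℝ, EM) ∞ Ψ (S ×ˢ Γ) := by
    refine (contMDiff_action EG EM G M).comp_contMDiffOn (ContMDiffOn.prodMk ?_ ?_)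
    · exact hγs.comp (ContDiff.contMDiff contDiff_snd).contMDiffOn (fun z hz => hz.2)
    · exact hσs.comp (ContDiff.contMDiff contDiff_fst).contMDiffOn (fun z hz => hz.1)
  set O : Set (EuclideanSpace ℝ (Fin n) × EG) := (S ×ˢ Γ) ∩ Ψ ⁻¹' c.source with hO
  have hOo : IsOpen O := hΨs.continuousOn.isOpen_inter_preimage (hSo.prod hΓo) c.open_source
  have h0Γ : (0 : EG) ∈ Γ := by simp [hΓ, he]
  have h0S : (0 : EuclideanSpace ℝ (Fin n)) ∈ S := by
    have : A (0 : EuclideanSpace ℝ (Fin n) × EG) = 0 := map_zero A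
    have h0 : A ((0 : EuclideanSpace ℝ (Fin n)), (0 : EG)) = 0 := this
    simp [hS, h0, hc]
  have h0O : (0 : EuclideanSpace ℝ (Fin n) × EG) ∈ O := by
    refine ⟨⟨h0S, h0Γ⟩, ?_⟩
    show γ 0 • σ 0 ∈ c.source
    rw [hγ0, hσ0, one_smul]
    exact mem_chart_source EM p
  have hf : ContDiffOn ℝ ∞ (fun z => c (Ψ z)) O := by
    refine ContMDiffOn.contDiffOn ?_
    exact (contMDiffOn_chart (I := 𝓘(ℝ, EM)) (n := ∞)).comp (hΨs.mono Set.inter_subset_left)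
      (fun z hz => hz.2)
  have hder : HasFDerivAt (fun z => c (Ψ z)) (A : _ →L[ℝ] EM) 0 := by
    have hd := ((hf.contDiffAt (hOo.mem_nhds h0O)).differentiableAt (by simp)).hasFDerivAt
    set D := fderiv ℝ (fun z => c (Ψ z)) 0
    -- In the chart `c` the slice is the affine map `x ↦ c p + A (x, 0)`, so its derivative is exact
    -- by construction.
    have h1 : D.comp (ContinuousLinearMap.inl ℝ _ EG) =
        (A : _ →L[ℝ] EM).comp (ContinuousLinearMap.inl ℝ _ EG) := by
      have e1 : HasFDerivAt (fun x : EuclideanSpace ℝ (Fin n) => c (Ψ (x, 0)))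
          (D.comp (ContinuousLinearMap.inl ℝ _ EG)) 0 :=
        HasFDerivAt.comp (g := fun z => c (Ψ z)) (0 : EuclideanSpace ℝ (Fin n)) hd
          (hasFDerivAt_prodMk_left 0 (0 : EG))
      have e2 : HasFDerivAt (fun x : EuclideanSpace ℝ (Fin n) => c p + A (x, 0))
          ((A : _ →L[ℝ] EM).comp (ContinuousLinearMap.inl ℝ _ EG)) 0 :=
        (HasFDerivAt.comp (0 : EuclideanSpace ℝ (Fin n)) A.hasFDerivAt
          (hasFDerivAt_prodMk_left 0 (0 : EG))).const_add (c p)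
      refine (e1.congr_of_eventuallyEq ?_).unique e2
      filter_upwards [hSo.mem_nhds h0S] with x hx
      show c p + A (x, 0) = c (γ 0 • σ x)
      rw [hγ0, one_smul]
      exact (c.right_inv hx).symm
    -- In the group direction the derivative is that of the orbit map read in charts, which `A` was
    -- built to extend.
    have h2 : D.comp (ContinuousLinearMap.inr ℝ _ EG) =
        (A : _ →L[ℝ] EM).comp (ContinuousLinearMap.inr ℝ (EuclideanSpace ℝ (Fin n)) EG) := by
      have e1 : HasFDerivAt (fun a : EG => c (Ψ (0, a)))
          (D.comp (ContinuousLinearMap.inr ℝ _ EG)) 0 :=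
        HasFDerivAt.comp (g := fun z => c (Ψ z)) (0 : EG) hd
          (hasFDerivAt_prodMk_right (0 : EuclideanSpace ℝ (Fin n)) (0 : EG))
      have e2 : HasFDerivAt (fun a : EG => c (γ a • p)) (modelDeriv EG EM (fun g : G => g • p) 1)
          0 := by
        have h := (mdifferentiable_orbitMap EG EM p (1 : G)).hasMFDerivAt.2
        simp only [writtenInExtChartAt, mfld_simps, one_smul,
          Function.comp_def] at h
        have h' : HasFDerivAt (fun b : EG => c (e.symm b • p))
          (modelDeriv EG EM (fun g : G => g • p) 1) (e 1 + 0) := by 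
            rw [add_zero]
            exact hasFDerivWithinAt_univ.1 h
        exact HasFDerivAt.comp (g := fun b : EG => c (e.symm b • p)) (0 : EG) h'
          ((hasFDerivAt_id (𝕜 := ℝ) (0 : EG)).const_add (e 1))
      have e3 := e1.unique (e2.congr_of_eventuallyEq (Filter.Eventually.of_forall fun a => by
        show c (γ a • σ 0) = c (γ a • p)
        rw [hσ0]))
      rw [e3]
      exact ContinuousLinearMap.ext fun a => (hA a).symm
    have h3 : D = (A : _ →L[ℝ] EM) := by
      refine ContinuousLinearMap.prod_ext ?_ ?_
      · exact h1
      · exact h2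
    rwa [h3] at hd
  have : CompleteSpace (EuclideanSpace ℝ (Fin n) × EG) := FiniteDimensional.complete ℝ _
  obtain ⟨φ, hφf, hφ0, hφO, hφs⟩ := exists_openPartialHomeomorph_contDiffOn_symm hOo hf h0O A hder
  set Φ := φ.trans c.symm with hΦ
  have hΦsrc : Φ.source = φ.source := by
    rw [hΦ, φ.trans_source]
    refine Set.inter_eq_left.2 fun z hz => ?_
    show φ z ∈ c.target
    rw [hφf]
    exact c.map_source (hφO hz).2
  have hΦΨ : ∀ z ∈ Φ.source, Φ z = Ψ z := by
    intro z hz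
    rw [hΦsrc] at hz
    show c.symm (φ z) = Ψ z
    rw [hφf]
    exact c.left_inv (hφO hz).2
  have hnhds : Φ.source ∈ 𝓝 ((0 : EuclideanSpace ℝ (Fin n)), (0 : EG)) :=
    Φ.open_source.mem_nhds (hΦsrc ▸ hφ0)
  obtain ⟨B, F, hBo, h0B, hFo, h0F, hBF⟩ := mem_nhds_prod_iff'.1 hnhds
  -- Group elements in `γ '' F` have coordinates in the box where `Φ` is injective; `V` and `U` are
  -- then chosen so that only these can carry one slice point to another.
  have hN : γ '' F ∈ 𝓝 (1 : G) := by
    have h1 : ContinuousAt (fun g : G => e g - e 1) 1 :=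
      (e.continuousAt (mem_chart_source EG (1 : G))).sub continuousAt_const
    filter_upwards [h1.eventually_mem (hFo.mem_nhds (by simpa using h0F)),
      e.open_source.mem_nhds (mem_chart_source EG (1 : G))] with g hg hg'
    exact ⟨_, hg, by simp [hγ, e.left_inv hg']⟩
  obtain ⟨V, hV, hVg⟩ := exists_nhds_smul_mem_imp hfree p hN
  have hσc : ContinuousAt σ 0 := (hσs.continuousOn).continuousAt (hSo.mem_nhds h0S)
  obtain ⟨U, hUV, hUo, h0U⟩ := mem_nhds_iff.1 (Filter.inter_mem (hBo.mem_nhds h0B)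
    (hσc.preimage_mem_nhds (by rwa [hσ0])))
  have hUB : U ×ˢ F ⊆ Φ.source := (Set.prod_mono_left fun x hx => (hUV hx).1).trans hBF
  have hΦ0 : ∀ x ∈ U, Φ (x, 0) = σ x := by
    intro x hx
    rw [hΦΨ _ (hUB ⟨hx, h0F⟩)]
    show γ 0 • σ x = σ x
    rw [hγ0, one_smul]
  set Φ' := Φ.restr (U ×ˢ F) with hΦ'
  have hsrc' : Φ'.source = U ×ˢ F := by
    rw [hΦ', Φ.restr_source' _ (hUo.prod hFo)]
    exact Set.inter_eq_right.2 hUB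
  refine ⟨⟨Φ'.symm, A, U, F, γ, hUo, hFo, h0F, hsrc', ?_, ?_, ?_, ?_, ?_, ?_⟩⟩
  · have : Φ' (0, 0) = p := (hΦ0 0 h0U).trans hσ0
    rw [← this]
    exact Φ'.map_source (hsrc' ▸ ⟨h0U, h0F⟩)
  · have h1 : ContMDiffOn 𝓘(ℝ, EM) 𝓘(ℝ, EuclideanSpace ℝ (Fin n) × EG) ∞
        (fun q => φ.symm (c q)) Φ.target :=
      hφs.contMDiffOn.comp ((contMDiffOn_chart (I := 𝓘(ℝ, EM)) (n := ∞)).mono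
        fun q hq => hq.1) fun q hq => hq.2
    exact h1.mono fun q hq => hq.1
  · have hsub : Φ'.symm.target ⊆ Φ.source := fun z hz => hz.1
    exact (hΨs.mono fun z hz => (hφO (hΦsrc ▸ hsub hz)).1).congr fun z hz => hΦΨ z (hsub hz)
  · refine hγs.mono fun a ha => ?_
    have h1 : ((0 : EuclideanSpace ℝ (Fin n)), a) ∈ Φ.source := hUB ⟨h0U, ha⟩
    exact (hφO (hΦsrc ▸ h1)).1.2
  · intro x hx a ha
    show Φ (x, a) = γ a • Φ (x, 0)
    rw [hΦ0 x hx, hΦΨ _ (hUB ⟨hx, ha⟩)]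
  · intro x hx x' hx' g hg
    change g • Φ (x, 0) = Φ (x', 0) at hg
    have hg' := hg
    rw [hΦ0 x hx, hΦ0 x' hx'] at hg
    -- With `g = γ a` the hypothesis reads `Φ (x, a) = Φ (x', 0)`, and injectivity gives `a = 0` and
    -- `x = x'`.
    obtain ⟨a, ha, rfl⟩ := hVg (σ x) (hUV hx).2 g (hg ▸ (hUV hx').2)
    have h1 : Φ (x, a) = Φ (x', 0) := by
      rw [hΦΨ _ (hUB ⟨hx, ha⟩), hΦ0 x' hx']; exact hg
    have h2 := Φ.injOn (hUB ⟨hx, ha⟩) (hUB ⟨hx', h0F⟩) h1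
    simp only [Prod.mk.injEq] at h2
    exact ⟨h2.2 ▸ hγ0, h2.1⟩

end Slices

/-! ### The orbit space and its charts -/

section OrbitProj

variable {G M : Type*} [Group G] [MulAction G M]

theorem orbitProj_eq_iff {p q : M} : orbitProj G M p = orbitProj G M q ↔ ∃ g : G, g • p = q := by
  rw [eq_comm]
  exact Quotient.eq (r := MulAction.orbitRel G M)

theorem orbitProj_smul (g : G) (p : M) : orbitProj G M (g • p) = orbitProj G M p :=
  (orbitProj_eq_iff.2 ⟨g, rfl⟩).symm

theorem orbitProj_surjective : Function.Surjective (orbitProj G M) := Quotient.mk_surjective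

variable [TopologicalSpace M]

theorem continuous_orbitProj : Continuous (orbitProj G M) := continuous_quot_mk

theorem isOpenMap_orbitProj [ContinuousConstSMul G M] : IsOpenMap (orbitProj G M) :=
  isOpenMap_quotient_mk'_mul

end OrbitProj

namespace SliceChart

variable {EG EM : Type*} [NormedAddCommGroup EG] [NormedSpace ℝ EG]
  [NormedAddCommGroup EM] [NormedSpace ℝ EM]
  {G M : Type*} [TopologicalSpace G] [ChartedSpace EG G] [Group G]
  [TopologicalSpace M] [ChartedSpace EM M] [MulAction G M] {n : ℕ} {p : M}
  (S : SliceChart EG EM G n p)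

theorem chart_mem {q : M} (hq : q ∈ S.chart.source) :
    (S.chart q).1 ∈ S.base ∧ (S.chart q).2 ∈ S.fiber := by
  have h := S.chart.map_source hq
  rw [S.target_eq] at h
  exact h

theorem mem_target {x : EuclideanSpace ℝ (Fin n)} (hx : x ∈ S.base) : (x, 0) ∈ S.chart.target := by
  rw [S.target_eq]
  exact ⟨hx, S.zero_mem_fiber⟩

theorem shift_smul {q : M} (hq : q ∈ S.chart.source) :
    S.shift (S.chart q).2 • S.chart.symm ((S.chart q).1, 0) = q := by
  rw [← S.symm_apply _ (S.chart_mem hq).1 _ (S.chart_mem hq).2]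
  exact S.chart.left_inv hq

/-- Undoing both shifts turns `g` into an element carrying one slice point to another, to which
`rigid` applies. The first part, an explicit formula for `g`, later gives smoothness of `θ`; the
second makes the base coordinate orbit-invariant. -/
theorem eq_of_smul_eq {q q' : M} (hq : q ∈ S.chart.source) (hq' : q' ∈ S.chart.source) {g : G}
    (h : g • q = q') : g = S.shift (S.chart q').2 * (S.shift (S.chart q).2)⁻¹ ∧
      (S.chart q).1 = (S.chart q').1 := by
  have h1 := S.rigid _ (S.chart_mem hq).1 _ (S.chart_mem hq').1
    ((S.shift (S.chart q').2)⁻¹ * g * S.shift (S.chart q).2) (by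
      rw [mul_smul, S.shift_smul hq, mul_smul, h, inv_smul_eq_iff, S.shift_smul hq'])
  refine ⟨?_, h1.2⟩
  have h2 := h1.1
  rw [mul_assoc, inv_mul_eq_one] at h2
  rw [h2]; group

/-- The coordinate along the base of a slice chart, as a function on the orbit space. -/
noncomputable def quotientCoord (y : MulAction.orbitRel.Quotient G M) :
    EuclideanSpace ℝ (Fin n) :=
  -- The choice of `q` is immaterial by `eq_of_smul_eq`; the value `0` occurs only off the chart
  -- domain.
  open scoped Classical in
  if h : ∃ q ∈ S.chart.source, orbitProj G M q = y then (S.chart h.choose).1 else 0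

theorem quotientCoord_orbitProj {q : M} (hq : q ∈ S.chart.source) :
    S.quotientCoord (orbitProj G M q) = (S.chart q).1 := by
  have h : ∃ q' ∈ S.chart.source, orbitProj G M q' = orbitProj G M q := ⟨q, hq, rfl⟩
  rw [quotientCoord, dif_pos h]
  obtain ⟨g, hg⟩ := orbitProj_eq_iff.1 h.choose_spec.2
  exact (S.eq_of_smul_eq h.choose_spec.1 hq hg).2

theorem orbitProj_symm_chart {q : M} (hq : q ∈ S.chart.source) :
    orbitProj G M (S.chart.symm ((S.chart q).1, 0)) = orbitProj G M q := by
  conv_rhs => rw [← S.shift_smul hq]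
  exact (orbitProj_smul _ _).symm

theorem quotientCoord_orbitProj_symm {x : EuclideanSpace ℝ (Fin n)} (hx : x ∈ S.base) :
    S.quotientCoord (orbitProj G M (S.chart.symm (x, 0))) = x := by
  rw [S.quotientCoord_orbitProj (S.chart.map_target (S.mem_target hx)),
    S.chart.right_inv (S.mem_target hx)]

/-- The chart of the orbit space induced by a slice chart. -/
noncomputable def quotientChart [ContinuousConstSMul G M] :
    OpenPartialHomeomorph (MulAction.orbitRel.Quotient G M) (EuclideanSpace ℝ (Fin n)) where
  toFun := S.quotientCoord
  invFun x := orbitProj G M (S.chart.symm (x, 0))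
  source := orbitProj G M '' S.chart.source
  target := S.base
  map_source' := by
    rintro _ ⟨q, hq, rfl⟩
    rw [S.quotientCoord_orbitProj hq]
    exact (S.chart_mem hq).1
  map_target' x hx := ⟨_, S.chart.map_target (S.mem_target hx), rfl⟩
  left_inv' := by
    rintro _ ⟨q, hq, rfl⟩
    rw [S.quotientCoord_orbitProj hq, S.orbitProj_symm_chart hq]
  right_inv' x hx := S.quotientCoord_orbitProj_symm hx
  open_source := isOpenMap_orbitProj _ S.chart.open_source
  open_target := S.isOpen_base
  continuousOn_toFun := by
    rintro _ ⟨q, hq, rfl⟩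
    refine ContinuousAt.continuousWithinAt ?_
    -- As the projection is open and continuous, neighbourhoods downstairs are pushed forward from
    -- `q`, and continuity can be tested on `M`.
    rw [ContinuousAt, ← isOpenMap_orbitProj.map_nhds_eq continuous_orbitProj.continuousAt,
      Filter.tendsto_map'_iff, S.quotientCoord_orbitProj hq]
    refine Filter.Tendsto.congr' ?_ (S.chart.continuousAt hq).fst
    filter_upwards [S.chart.open_source.mem_nhds hq] with q' hq'
    exact (S.quotientCoord_orbitProj hq').symm
  continuousOn_invFun := continuous_orbitProj.comp_continuousOn
    (S.chart.continuousOn_symm.comp (by fun_prop) fun x hx => S.mem_target hx)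

theorem mem_quotientChart_source [ContinuousConstSMul G M] :
    orbitProj G M p ∈ S.quotientChart.source := ⟨p, S.mem_source, rfl⟩

end SliceChart

/-! ### The smooth structure on the orbit space -/

section QuotientManifold

variable {EG EM : Type*} [NormedAddCommGroup EG] [NormedSpace ℝ EG]
  [NormedAddCommGroup EM] [NormedSpace ℝ EM]
  {G M : Type*} [TopologicalSpace G] [ChartedSpace EG G] [Group G]
  [TopologicalSpace M] [ChartedSpace EM M] [MulAction G M]
  {n : ℕ}

/-- The charted space structure on the orbit space given by a family of slice charts. -/
@[reducible]
noncomputable def orbitChartedSpace [ContinuousConstSMul G M]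
    (S : ∀ p : M, SliceChart EG EM G n p) :
    ChartedSpace (EuclideanSpace ℝ (Fin n)) (MulAction.orbitRel.Quotient G M) where
  atlas := Set.range fun p => (S p).quotientChart
  chartAt y := (S (Function.surjInv orbitProj_surjective y)).quotientChart
  mem_chart_source y := by
    have h := (S (Function.surjInv orbitProj_surjective y)).mem_quotientChart_source
    rwa [Function.surjInv_eq orbitProj_surjective] at h
  chart_mem_atlas y := ⟨_, rfl⟩

theorem SliceChart.contMDiffOn_symm_base {p : M} (S : SliceChart EG EM G n p) :
    ContMDiffOn 𝓘(ℝ, EuclideanSpace ℝ (Fin n)) 𝓘(ℝ, EM) ∞ (fun x => S.chart.symm (x, 0)) S.base :=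
  S.contMDiffOn_symm.comp (ContDiff.contMDiff (contDiff_prodMk_left 0)).contMDiffOn
    fun _ hx => S.mem_target hx

theorem SliceChart.contMDiffAt_chart {p q : M} (S : SliceChart EG EM G n p)
    (hq : q ∈ S.chart.source) :
    ContMDiffAt 𝓘(ℝ, EM) 𝓘(ℝ, EuclideanSpace ℝ (Fin n) × EG) ∞ S.chart q :=
  S.contMDiffOn_chart.contMDiffAt (S.chart.open_source.mem_nhds hq)

variable [ContMDiffSMul 𝓘(ℝ, EG) 𝓘(ℝ, EM) ∞ G M]

/-- Lift `x` to the first slice, move it by one fixed `g` into the domain of the second chart, and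
read off the base coordinate: near `x` this composite of smooth maps is the transition. -/
theorem SliceChart.contDiffOn_transition [ContinuousConstSMul G M] {p p' : M}
    (S : SliceChart EG EM G n p)
    (S' : SliceChart EG EM G n p') : ContDiffOn ℝ ∞ (S'.quotientChart ∘ S.quotientChart.symm)
      (S.quotientChart.symm.trans S'.quotientChart).source := by
  rintro x ⟨hx, q, hq, hqx⟩
  change x ∈ S.base at hx
  obtain ⟨g, hg⟩ := orbitProj_eq_iff.1 hqx.symm
  have h1 : ContMDiffAt 𝓘(ℝ, EuclideanSpace ℝ (Fin n)) 𝓘(ℝ, EM) ∞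
      (fun z => g • S.chart.symm (z, 0)) x :=
    (contMDiff_translation EG EM M g).contMDiffAt.comp x
      (S.contMDiffOn_symm_base.contMDiffAt (S.isOpen_base.mem_nhds hx))
  have h2 : ContMDiffAt 𝓘(ℝ, EuclideanSpace ℝ (Fin n)) 𝓘(ℝ, EuclideanSpace ℝ (Fin n)) ∞
      (fun z => (S'.chart (g • S.chart.symm (z, 0))).1) x := by
    refine (ContDiff.contMDiff contDiff_fst).contMDiffAt.comp x
      (ContMDiffAt.comp x (S'.contMDiffAt_chart ?_) h1)
    exact hg ▸ hq
  refine (h2.contDiffAt.congr_of_eventuallyEq ?_).contDiffWithinAt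
  have h3 : ∀ᶠ z in 𝓝 x, g • S.chart.symm (z, 0) ∈ S'.chart.source :=
    h1.continuousAt.eventually_mem (S'.chart.open_source.mem_nhds (by exact hg ▸ hq))
  filter_upwards [h3] with z hz
  rw [← S'.quotientCoord_orbitProj hz, orbitProj_smul]
  rfl

theorem isManifold_orbitChartedSpace [ContinuousConstSMul G M]
    (S : ∀ p : M, SliceChart EG EM G n p) :
    @IsManifold ℝ _ _ _ _ _ _ (𝓡 n) ∞ (MulAction.orbitRel.Quotient G M) _
      (orbitChartedSpace S) := by
  let := orbitChartedSpace S
  refine isManifold_of_contDiffOn (𝓡 n) ∞ _ ?_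
  rintro _ _ ⟨p, rfl⟩ ⟨p', rfl⟩
  simpa using (S p).contDiffOn_transition (S p')

theorem isSubmersion_orbitProj [IsManifold 𝓘(ℝ, EM) ∞ M] [ContinuousConstSMul G M]
    (S : ∀ p : M, SliceChart EG EM G n p) :
    letI := orbitChartedSpace S
    Manifold.IsSubmersion 𝓘(ℝ, EM) (𝓡 n) ∞ (orbitProj G M) := by
  let := orbitChartedSpace S
  have := isManifold_orbitChartedSpace S
  suffices h : Manifold.IsSubmersionOfComplement EG 𝓘(ℝ, EM) (𝓡 n) ∞ (orbitProj G M) from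
    h.isSubmersion
  intro q
  set y := orbitProj G M q with hy
  set p := Function.surjInv orbitProj_surjective y
  have hp : orbitProj G M p = y := Function.surjInv_eq orbitProj_surjective y
  -- The chart at `y` comes from a chosen representative `p`, not from `q`; translating by `g⁻¹`
  -- brings `q` into its slice chart, and `model` carries the coordinates to `EM`.
  obtain ⟨g, hg⟩ := orbitProj_eq_iff.1 (hp.trans hy)
  set e : OpenPartialHomeomorph M EM := ((Homeomorph.smul g⁻¹).toOpenPartialHomeomorph.trans
    (S p).chart).trans (S p).model.toHomeomorph.toOpenPartialHomeomorph with he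
  have hesrc : e.source = {q' : M | g⁻¹ • q' ∈ (S p).chart.source} := by
    ext q'
    simp [he]
  have hetgt : e.target = {z : EM | (S p).model.symm z ∈ (S p).chart.target} := by
    ext q'
    simp [he]
  have hsymm (z : EM) : e.symm z = g • (S p).chart.symm ((S p).model.symm z) := by
    simp [he]
  have hqe : g⁻¹ • q ∈ (S p).chart.source := by
    rw [← hg, inv_smul_smul]
    exact (S p).mem_source
  refine Manifold.IsSubmersionAtOfComplement.mk_of_continuousAt continuous_orbitProj.continuousAt
    (S p).model.symm e (chartAt _ y) ?_ (mem_chart_source _ y) ?_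
    (IsManifold.chart_mem_maximalAtlas y) ?_
  · rw [hesrc]
    exact hqe
  · refine e.mem_maximalAtlas_of_contMDiffOn ?_ ?_
    · rw [hesrc]
      exact (ContDiff.contMDiff (S p).model.contDiff).comp_contMDiffOn
        ((S p).contMDiffOn_chart.comp (contMDiff_translation EG EM M g⁻¹).contMDiffOn
          fun q' hq' => hq')
    · rw [hetgt]
      refine ContMDiffOn.congr (f := fun z => g • (S p).chart.symm ((S p).model.symm z)) ?_
        fun z _ => hsymm z
      exact (contMDiff_translation EG EM M g).comp_contMDiffOn
        ((S p).contMDiffOn_symm.comp (ContDiff.contMDiff (S p).model.symm.contDiff).contMDiffOn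
          fun z hz => hz)
  · intro z hz
    have hz' : (S p).model.symm z ∈ (S p).chart.target := by
      have : z ∈ e.target := by simpa using hz
      rwa [hetgt] at this
    show (S p).quotientCoord (orbitProj G M (e.symm z)) = ((S p).model.symm z).1
    rw [hsymm, orbitProj_smul, (S p).quotientCoord_orbitProj ((S p).chart.map_target hz'),
      (S p).chart.right_inv hz']

end QuotientManifold

theorem comp_smulRight_one {E F : Type*} [NormedAddCommGroup E] [NormedSpace ℝ E]
    [NormedAddCommGroup F] [NormedSpace ℝ F] (L : E →L[ℝ] F) (u : E) :
    L.comp ((1 : ℝ →L[ℝ] ℝ).smulRight u) = (1 : ℝ →L[ℝ] ℝ).smulRight (L u) := by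
  ext; simp

/-! ### Reduction along a global section -/

section GlobalSection

variable {EG EM : Type*} [NormedAddCommGroup EG] [NormedSpace ℝ EG]
  [NormedAddCommGroup EM] [NormedSpace ℝ EM]
  {G M : Type*} [TopologicalSpace G] [ChartedSpace EG G] [Group G]
  [TopologicalSpace M] [ChartedSpace EM M]
  [MulAction G M] [ContMDiffSMul 𝓘(ℝ, EG) 𝓘(ℝ, EM) ∞ G M]

/-- Weak invariance in terms of partial derivatives. -/
theorem IsWeaklyInvariant.modelDeriv_add {V : ∀ p : M, TangentSpace 𝓘(ℝ, EM) p}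
    {W : ∀ g : G, TangentSpace 𝓘(ℝ, EG) g} (hVW : IsWeaklyInvariant V W) (g : G) (p : M) :
    modelDeriv EG EM (fun h : G => h • p) g (W g) +
      modelDeriv EM EM (fun q : M => g • q) p (V p) = (V (g • p) : EM) :=
  (mfderiv_prod_apply_eq_modelDeriv (mdifferentiable_action EG EM G M (g, p)) _ _).symm.trans
    (hVW g p)

variable {n : ℕ} [ChartedSpace (EuclideanSpace ℝ (Fin n)) (MulAction.orbitRel.Quotient G M)]
  {s : MulAction.orbitRel.Quotient G M → M} {θ : M → G} {v : M → EM} {w : G → EG}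

/-- The image of a weakly invariant field under the differential of the orbit projection is
constant along orbits. -/
theorem modelDeriv_orbitProj_smul
    (hvw : ∀ (g : G) (p : M), modelDeriv EG EM (fun h : G => h • p) g (w g) +
      modelDeriv EM EM (fun q : M => g • q) p (v p) = v (g • p))
    (hπ : MDifferentiable 𝓘(ℝ, EM) (𝓡 n) (orbitProj G M)) (g : G) (p : M) :
    modelDeriv EM (EuclideanSpace ℝ (Fin n)) (orbitProj G M) (g • p) (v (g • p)) =
      modelDeriv EM (EuclideanSpace ℝ (Fin n)) (orbitProj G M) p (v p) := by
  have h1 := modelDeriv_comp_apply (hπ (g • p)) (mdifferentiable_orbitMap EG EM p g) rfl (w g)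
  have h2 := modelDeriv_comp_apply (hπ (g • p)) (mdifferentiable_translation EG EM M g p) rfl (v p)
  simp_rw [orbitProj_smul] at h1 h2
  -- The `w` part is tangent to the orbit, where the projection is constant.
  rw [← hvw g p, map_add, ← h2, ← h1, modelDeriv_const]
  exact zero_add _

/-- Splitting of a tangent vector along the orbit and along the section. -/
theorem modelDeriv_groupComponent_add (hπ : MDifferentiable 𝓘(ℝ, EM) (𝓡 n) (orbitProj G M))
    (hs : MDifferentiable (𝓡 n) 𝓘(ℝ, EM) s)
    (hθ : ∀ q, θ q • s (orbitProj G M q) = q)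
    (hθs : MDifferentiable 𝓘(ℝ, EM) 𝓘(ℝ, EG) θ) (q : M) (u : EM) :
    modelDeriv EG EM (fun g : G => g • s (orbitProj G M q)) (θ q) (modelDeriv EM EG θ q u) +
      modelDeriv EM EM (fun p : M => θ q • p) (s (orbitProj G M q))
        (modelDeriv (EuclideanSpace ℝ (Fin n)) EM s (orbitProj G M q)
          (modelDeriv EM (EuclideanSpace ℝ (Fin n)) (orbitProj G M) q u)) = u := by
  -- This differentiates the identity `θ q • s (π q) = q` by the two-variable chain rule.
  have h1 := modelDeriv_comp₂_apply (f := fun x : G × M => x.1 • x.2) (a := θ)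
    (b := fun q => s (orbitProj G M q)) (mdifferentiable_action EG EM G M _) (hθs q)
    ((hs _).comp q (hπ q)) rfl rfl u
  simp_rw [hθ, modelDeriv_id] at h1
  rw [← modelDeriv_comp_apply (hs _) (hπ q) rfl]
  exact h1.symm

variable [LieGroup 𝓘(ℝ, EG) ∞ G]

/-- The group component of a point with respect to a smooth global section is smooth. -/
theorem contMDiff_groupComponent {m : ℕ} (S : ∀ p : M, SliceChart EG EM G m p)
    (hπ : ContMDiff 𝓘(ℝ, EM) (𝓡 n) ∞ (orbitProj G M)) (hs : IsSmoothSection (EM := EM) n s)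
    (hθ : ∀ q, θ q • s (orbitProj G M q) = q) :
    ContMDiff 𝓘(ℝ, EM) 𝓘(ℝ, EG) ∞ θ := by
  intro q
  set p := s (orbitProj G M q) with hp
  set g₀ := θ q
  have hsπ : ContMDiff 𝓘(ℝ, EM) 𝓘(ℝ, EM) ∞ (fun q' => s (orbitProj G M q')) := hs.1.comp hπ
  have htr : ContMDiff 𝓘(ℝ, EM) 𝓘(ℝ, EM) ∞ (fun q' : M => g₀⁻¹ • q') :=
    contMDiff_translation EG EM M g₀⁻¹
  have h0 : g₀⁻¹ • q = p := inv_smul_eq_iff.2 (hθ q).symm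
  have hshift (f : M → M) (hf : ContMDiff 𝓘(ℝ, EM) 𝓘(ℝ, EM) ∞ f) (hfq : f q = p) :
      ContMDiffAt 𝓘(ℝ, EM) 𝓘(ℝ, EG) ∞ (fun q' => (S p).shift ((S p).chart (f q')).2) q := by
    have hmem : f q ∈ (S p).chart.source := hfq ▸ (S p).mem_source
    have h1 : ContMDiffAt 𝓘(ℝ, EM) 𝓘(ℝ, EG) ∞ (fun q' => ((S p).chart (f q')).2) q :=
      (ContDiff.contMDiff contDiff_snd).contMDiffAt.comp q
        (((S p).contMDiffAt_chart hmem).comp q hf.contMDiffAt)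
    exact ContMDiffAt.comp (g := (S p).shift) q ((S p).contMDiffOn_shift.contMDiffAt
      ((S p).isOpen_fiber.mem_nhds ((S p).chart_mem hmem).2)) h1
  -- Near `q`, `g₀⁻¹ * θ q'` carries `s (π q')` to `g₀⁻¹ • q'`, both inside one slice chart, so
  -- `eq_of_smul_eq` forces this formula.
  have hsm : ContMDiffAt 𝓘(ℝ, EM) 𝓘(ℝ, EG) ∞ (fun q' =>
      g₀ * ((S p).shift ((S p).chart (g₀⁻¹ • q')).2 *
        ((S p).shift ((S p).chart (s (orbitProj G M q'))).2)⁻¹)) q :=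
    contMDiffAt_const.mul ((hshift _ htr h0).mul (hshift _ hsπ rfl).inv)
  refine hsm.congr_of_eventuallyEq ?_
  have hopen := (S p).chart.open_source
  filter_upwards [htr.continuous.continuousAt.eventually_mem
      (hopen.mem_nhds (h0 ▸ (S p).mem_source)),
    hsπ.continuous.continuousAt.eventually_mem (hopen.mem_nhds (S p).mem_source)] with q' h1 h2
  rw [← ((S p).eq_of_smul_eq h2 h1 (g := g₀⁻¹ * θ q') (by rw [mul_smul, hθ])).1]
  group

variable [IsManifold 𝓘(ℝ, EM) ∞ M] [CompleteSpace EG]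

/-- The evolution of the group component along a weakly invariant field. -/
theorem modelDeriv_groupComponent_apply (hfree : ∀ (g : G) (p : M), g • p = p → g = 1)
    (hvw : ∀ (g : G) (p : M), modelDeriv EG EM (fun h : G => h • p) g (w g) +
      modelDeriv EM EM (fun q : M => g • q) p (v p) = v (g • p))
    (hπ : MDifferentiable 𝓘(ℝ, EM) (𝓡 n) (orbitProj G M))
    (hs : MDifferentiable (𝓡 n) 𝓘(ℝ, EM) s)
    (hθ : ∀ q, θ q • s (orbitProj G M q) = q)
    (hθs : MDifferentiable 𝓘(ℝ, EM) 𝓘(ℝ, EG) θ) {a : EG} {q : M}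
    (ha : modelDeriv EG EM (fun g : G => g • s (orbitProj G M q)) 1 a +
      modelDeriv (EuclideanSpace ℝ (Fin n)) EM s (orbitProj G M q)
        (modelDeriv EM (EuclideanSpace ℝ (Fin n)) (orbitProj G M) q (v q)) =
        v (s (orbitProj G M q))) :
    modelDeriv EM EG θ q (v q) = w (θ q) + leftInvariantField G a (θ q) := by
  -- Both candidates have the same image under the orbit map's differential: by the splitting of `v
  -- q` on one side, by weak invariance at `s (π q)` on the other.
  apply modelDeriv_orbitMap_injective (EM := EM) hfree (s (orbitProj G M q)) (θ q)
  have h1 := modelDeriv_groupComponent_add hπ hs hθ hθs q (v q)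
  have h2 := hvw (θ q) (s (orbitProj G M q))
  rw [hθ, ← ha, map_add, ← add_assoc] at h2
  rw [map_add, modelDeriv_orbitMap_leftInvariantField]
  exact add_right_cancel (h1.trans h2.symm)

end GlobalSection

/-! ### The main theorem -/

theorem mainTheorem5
    {EG EM : Type*}
    [NormedAddCommGroup EG] [NormedSpace ℝ EG] [FiniteDimensional ℝ EG]
    [NormedAddCommGroup EM] [NormedSpace ℝ EM] [FiniteDimensional ℝ EM]
    {G M : Type*}
    [TopologicalSpace G] [T2Space G] [SecondCountableTopology G] [ChartedSpace EG G]
    [Group G] [LieGroup 𝓘(ℝ, EG) ∞ G]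
    [TopologicalSpace M] [T2Space M] [SecondCountableTopology M] [ChartedSpace EM M]
    [IsManifold 𝓘(ℝ, EM) ∞ M]
    [MulAction G M] [ContMDiffSMul 𝓘(ℝ, EG) 𝓘(ℝ, EM) ∞ G M] [ProperSMul G M]
    (hfree : ∀ (g : G) (p : M), g • p = p → g = 1)
    (V : ∀ p : M, TangentSpace 𝓘(ℝ, EM) p) (hV : IsSmoothVectorField V)
    (W : ∀ g : G, TangentSpace 𝓘(ℝ, EG) g) (hW : IsGroupLinear W)
    (hVW : IsWeaklyInvariant V W) :
    (∃ (n : ℕ) (_ : ChartedSpace (EuclideanSpace ℝ (Fin n)) (MulAction.orbitRel.Quotient G M)),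
      IsManifold (𝓡 n) ∞ (MulAction.orbitRel.Quotient G M) ∧
        Manifold.IsSubmersion 𝓘(ℝ, EM) (𝓡 n) ∞ (orbitProj G M)) ∧
    ∀ (n : ℕ) [ChartedSpace (EuclideanSpace ℝ (Fin n)) (MulAction.orbitRel.Quotient G M)]
      [IsManifold (𝓡 n) ∞ (MulAction.orbitRel.Quotient G M)],
      Manifold.IsSubmersion 𝓘(ℝ, EM) (𝓡 n) ∞ (orbitProj G M) →
      ∀ s : MulAction.orbitRel.Quotient G M → M, IsSmoothSection (EM := EM) n s →
      ∃ (Vq : ∀ y : MulAction.orbitRel.Quotient G M, TangentSpace (𝓡 n) y)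
        (Vhat : MulAction.orbitRel.Quotient G M → GroupLieAlgebra 𝓘(ℝ, EG) G),
        IsSmoothVectorField Vq ∧ IsReducedField n V Vq ∧ IsForcingTerm n s V Vq Vhat ∧
        (∀ q : M, ∃! gy : G × MulAction.orbitRel.Quotient G M, q = gy.1 • s gy.2) ∧
        (∀ (J : Set ℝ) (p : ℝ → M) (g : ℝ → G) (y : ℝ → MulAction.orbitRel.Quotient G M),
          J.OrdConnected →
          IsMIntegralCurveOn p V J →
          (∀ t ∈ J, p t = g t • s (y t)) →
          IsMIntegralCurveOn y Vq J ∧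
          ∀ t ∈ J, HasMFDerivWithinAt 𝓘(ℝ, ℝ) 𝓘(ℝ, EG) g J t
            ((1 : ℝ →L[ℝ] ℝ).smulRight
              (W (g t) + mulInvariantVectorField (Vhat (y t)) (g t)))) ∧
        (∀ y : MulAction.orbitRel.Quotient G M,
          IsGroupAffine (fun g : G => W g + mulInvariantVectorField (Vhat y) g)) := by
  have : CompleteSpace EG := FiniteDimensional.complete ℝ EG
  let S (p : M) := Classical.choice (nonempty_sliceChart (EG := EG) (EM := EM) hfree p)
  refine ⟨⟨_, orbitChartedSpace S, isManifold_orbitChartedSpace S, isSubmersion_orbitProj S⟩, ?_⟩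
  intro n _ _ hsub s hs
  have hπ : ContMDiff 𝓘(ℝ, EM) (𝓡 n) ∞ (orbitProj G M) := hsub.contMDiff
  have hπd : MDifferentiable 𝓘(ℝ, EM) (𝓡 n) (orbitProj G M) := hπ.mdifferentiable (by simp)
  have hsd : MDifferentiable (𝓡 n) 𝓘(ℝ, EM) s := hs.1.mdifferentiable (by simp)
  have hex (q : M) : ∃ g : G, g • s (orbitProj G M q) = q := orbitProj_eq_iff.1 (hs.2 _)
  choose θ hθ using hex
  have hθs : ContMDiff 𝓘(ℝ, EM) 𝓘(ℝ, EG) ∞ θ := contMDiff_groupComponent S hπ hs hθ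
  have hθd : MDifferentiable 𝓘(ℝ, EM) 𝓘(ℝ, EG) θ := hθs.mdifferentiable (by simp)
  have hdecomp (g : G) (y : MulAction.orbitRel.Quotient G M) :
      orbitProj G M (g • s y) = y ∧ θ (g • s y) = g := by
    have h1 : orbitProj G M (g • s y) = y := (orbitProj_smul _ _).trans (hs.2 y)
    have h2 := hθ (g • s y)
    rw [h1] at h2
    refine ⟨h1, ?_⟩
    have h3 := hfree (g⁻¹ * θ (g • s y)) (s y) (by rw [mul_smul, h2, inv_smul_smul])
    exact (inv_mul_eq_one.1 h3).symm
  let Vq (y : MulAction.orbitRel.Quotient G M) : EuclideanSpace ℝ (Fin n) :=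
    modelDeriv EM (EuclideanSpace ℝ (Fin n)) (orbitProj G M) (s y) (V (s y))
  -- As `θ (s y) = 1`, the splitting at `s y` shows that this is the required preimage.
  let Vhat (y : MulAction.orbitRel.Quotient G M) : EG := modelDeriv EM EG θ (s y) (V (s y))
  have hvw (g : G) (p : M) := hVW.modelDeriv_add g p
  have hVq (q : M) : Vq (orbitProj G M q) =
      modelDeriv EM (EuclideanSpace ℝ (Fin n)) (orbitProj G M) q (V q) := by
    have h1 := modelDeriv_orbitProj_smul (v := V) (w := W) hvw hπd (θ q) (s (orbitProj G M q))
    rw [hθ] at h1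
    exact h1.symm
  have hVhat (y : MulAction.orbitRel.Quotient G M) :
      modelDeriv EG EM (fun g : G => g • s y) 1 (Vhat y) +
        modelDeriv (EuclideanSpace ℝ (Fin n)) EM s y (Vq y) = (V (s y) : EM) := by
    have h1 := modelDeriv_groupComponent_add hπd hsd hθ hθd (s y) (V (s y))
    have h2 : θ (s y) = 1 := by simpa using (hdecomp 1 y).2
    rw [hs.2, h2] at h1
    simp_rw [one_smul, modelDeriv_id] at h1
    exact h1
  let w : G → EG := W
  have hgroup (q : M) : modelDeriv EM EG θ q (V q) =
      w (θ q) + leftInvariantField G (Vhat (orbitProj G M q)) (θ q) := by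
    refine modelDeriv_groupComponent_apply (v := V) (w := w) hfree hvw hπd hsd hθ hθd ?_
    rw [← hVq]
    exact hVhat _
  refine ⟨Vq, Vhat, ?_, hVq, ?_, ?_, ?_, ?_⟩
  · refine (((hπ.contMDiff_tangentMap (m := ∞) le_rfl).comp hV).comp hs.1).congr fun y => ?_
    exact Bundle.TotalSpace.ext (hs.2 y).symm HEq.rfl
  · intro y
    have h1 : Function.Injective (modelDeriv EG EM (fun g : G => g • s y) 1) :=
      modelDeriv_orbitMap_one_injective hfree (s y)
    exact ⟨h1, eq_sub_of_add_eq (hVhat y)⟩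
  · intro q
    refine ⟨(θ q, orbitProj G M q), (hθ q).symm, ?_⟩
    rintro ⟨g, y⟩ rfl
    exact Prod.ext (hdecomp g y).2.symm (hdecomp g y).1.symm
  · intro J p g y _ hp hpgy
    -- Uniqueness of the decomposition determines `y` and `g` from `p` on `J`, so their
    -- differentiability is a conclusion.
    have hy : ∀ t ∈ J, y t = orbitProj G M (p t) := fun t ht => by
      rw [hpgy t ht, (hdecomp _ _).1]
    have hg : ∀ t ∈ J, g t = θ (p t) := fun t ht => by
      rw [hpgy t ht, (hdecomp _ _).2]
    refine ⟨fun t ht => ?_, fun t ht => ?_⟩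
    · have h1 := ((hπd (p t)).hasMFDerivAt.comp_hasMFDerivWithinAt t (hp t ht)).congr_mono hy (hy t ht)
        subset_rfl
      have h2 : (modelDeriv EM (EuclideanSpace ℝ (Fin n)) (orbitProj G M) (p t)).comp
          ((1 : ℝ →L[ℝ] ℝ).smulRight (V (p t) : EM)) = (1 : ℝ →L[ℝ] ℝ).smulRight (Vq (y t)) := by
        rw [hy t ht, hVq]
        exact comp_smulRight_one _ _
      exact h1.congr_mfderiv h2
    · have h1 := ((hθd (p t)).hasMFDerivAt.comp_hasMFDerivWithinAt t (hp t ht)).congr_mono hg (hg t ht)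
        subset_rfl
      have h2 : (modelDeriv EM EG θ (p t)).comp ((1 : ℝ →L[ℝ] ℝ).smulRight (V (p t) : EM)) =
          (1 : ℝ →L[ℝ] ℝ).smulRight (w (g t) + leftInvariantField G (Vhat (y t)) (g t)) := by
        rw [hy t ht, hg t ht, ← hgroup]
        exact comp_smulRight_one _ _
      exact h1.congr_mfderiv h2
  · exact fun y => hW.isGroupAffine_add (Vhat y)
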